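/- Let $f$ be a probability density on $\mathbb R$ (with respect to Lebesgue measure) that is not almost everywhere equal to the density of a normal distribution, and suppose that $\int |x|^m f(x)\,dx<\infty$ for all $m>0$. Let $\lambda_1,\dots,\lambda_d\in(0,\infty)$ and let $X=(X_1,\dots,X_d)^{\top}$ be a random vector with independent components such that $X_j$ has density $f_{\lambda_j}:=\lambda_j f(\lambda_j\,\cdot)$ for $1\le j\le d$. Let $\epsilon$ be a real random variable, independent of $X$, such that the set of zeros of its characteristic function $t\mapsto \mathbb E[e^{it\epsilon}]$ contains no nonempty open interval. Let $Y$ be a real random variable (possibly on another probability space) and put $$\mathcal B_0=\{\beta\in\mathbb R^d:\ Y\overset{d}{=}\beta^{\top}X+\epsilon\},$$ where $\overset{d}{=}$ denotes equality in distribution. Suppose that $\beta_0=(\beta_{01},\dots,\beta_{0d})^{\top}\in\mathcal B_0$. Then $$\Big\{\beta\in\mathbb R^d:\ \text{there is a permutation }\sigma\text{ of }\{1,\dots,d\}\text{ with }\beta_j=\tfrac{\lambda_j}{\lambda_{\sigma(j)}}\beta_{0\sigma(j)}\text{ for all }j\Big\}\subseteq\mathcal B_0$$ and $$\mathcal B_0\subseteq\Big\{\beta\in\mathbb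 R^d:\ \text{there is a permutation }\sigma\text{ of }\{1,\dots,d\}\text{ with }|\beta_j|=\tfrac{\lambda_j}{\lambda_{\sigma(j)}}|\beta_{0\sigma(j)}|\text{ for all }j\Big\}.$$ Moreover, if $f$ is symmetric around $0$ (that is, $f(-x)=f(x)$ for almost every $x$), then the second inclusion is an equality. -/

import Mathlib

open MeasureTheory ProbabilityTheory Set

open scoped NNReal

/-- `f` is a probability density on the real line (with respect to Lebesgue measure). -/
structure IsProbDensity (f : ℝ → ℝ) : Prop where
  measurable : Measurable f
  nonneg : ∀ x, 0 ≤ f x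
  integrable : Integrable f
  integral_eq_one : ∫ x, f x = 1

/-- `f` is a version of the density of a normal distribution `N(μ, v)` with variance `v > 0`.
Densities are only determined up to Lebesgue-null sets, hence the equality almost everywhere. -/
def IsGaussianDensity (f : ℝ → ℝ) : Prop :=
  ∃ (μ : ℝ) (v : ℝ≥0), v ≠ 0 ∧ f =ᵐ[volume] gaussianPDFReal μ v

/-- All absolute moments `∫ |x| ^ m f(x) dx` of positive order are finite. -/
def HasAllMoments (f : ℝ → ℝ) : Prop :=
  ∀ m : ℕ, 0 < m → Integrable (fun x : ℝ => |x| ^ m * f x)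

/-- `f` is symmetric around `0` (up to a Lebesgue-null set, as for any property of a density). -/
def IsSymmetricDensity (f : ℝ → ℝ) : Prop :=
  ∀ᵐ x : ℝ, f (-x) = f x

/-- The member `f_ℓ = ℓ f(ℓ ·)` of the scale family generated by `f`. -/
def scaleDensity (f : ℝ → ℝ) (ℓ : ℝ) : ℝ → ℝ :=
  fun x => ℓ * f (ℓ * x)

/-- The real random variable `Z` has Lebesgue density `g` under `P`. -/
def HasDensity {Ω : Type*} [MeasurableSpace Ω] (P : Measure Ω) (Z : Ω → ℝ) (g : ℝ → ℝ) : Prop :=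
  AEMeasurable Z P ∧ P.map Z = volume.withDensity (fun x => ENNReal.ofReal (g x))

/-- The set of all regression vectors in the unlinked linear regression model, that is, of all
`β` such that `Y` and `βᵀ X + ε` are equal in distribution. The response `Y` may live on a
probability space of its own. -/
def regressionVectors {Ω Ω' : Type*} [MeasurableSpace Ω] [MeasurableSpace Ω']
    (P : Measure Ω) (P' : Measure Ω') {d : ℕ}
    (X : Ω → Fin d → ℝ) (ε : Ω → ℝ) (Y : Ω' → ℝ) : Set (Fin d → ℝ) :=
  {β | IdentDistrib Y (fun ω => (∑ j, β j * X ω j) + ε ω) P' P}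

/-!
Write `μ` for the law with density `f`, `φ` for its characteristic function and
`γ j = β j / lam j`. By independence and scaling, the characteristic function of `βᵀ X + ε` at `t`
is `∏ j, φ (γ j * t)` times that of `ε` (`charFun_map_linear_combination_add`). The factor of `ε`
is nonzero on a dense set, so by continuity `β` is a regression vector if and only if
`∏ j, φ (γ j * t) = ∏ j, φ (γ₀ j * t)` for all `t`. The right-hand side is invariant under
permutations, and under sign changes if `f` is symmetric; this gives the easy inclusions.

For the remaining inclusion (`exists_perm_abs_eq_of_prod_charFun_eq`), pass to `ψ = ‖φ‖ ^ 2`, which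
is even, so that only the `|γ j|` matter, and take logarithms near `0`: the smooth function
`g = log ψ` satisfies `∑ g (|γ j| * t) = ∑ g (|γ₀ j| * t)`. If the absolute values do not agree up
to order, isolate the largest one which does not cancel. After rescaling, `g` is a linear
combination of dilates `g (c * t)` with `|c| < 1`; differentiating `k` times multiplies the weights
by `c ^ k`, so for large `k` the relation contracts the supremum norm and the `k`-th derivative
vanishes near `0`. Hence `ψ = exp p` near `0` for a polynomial `p`
(`exists_perm_or_polynomial_of_sum_dilate_eq`).

This forces `μ` to be Gaussian (`eq_gaussianReal_of_norm_sq_charFun_eq_exp`). Indeed `ψ` is the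
characteristic function of the difference of two independent variables with law `μ`; as `exp p` is
entire, Cauchy's estimates for its moments make the moment generating function finite everywhere,
and then the same holds for `μ`. So the complex moment generating function `M` of `μ` is entire and
`M z * M (-z) = exp (p (-I * z))` throughout, whence `M` has no zeros and `M = exp Q` with `Q`
entire. The bounds `‖M z‖ ≤ M (re z)` and `M x ≥ exp (x * m)`, where `m` is the mean, control the
real part of `Q` polynomially, so `Q` is a polynomial by the Borel–Carathéodory theorem. Finally
`re (Q z) ≤ re (Q (re z))` is impossible in degree three or more.
-/

/-! ### Functional equations between dilates -/

/-- Differentiating a linear relation between dilates of `h 0` repeatedly; here and below, `h k`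
stands for the `k`-th derivative of `h 0` on the interval `(-δ, δ)`. -/
lemma sum_mul_pow_mul_iterate_deriv_eq {ι : Type*} {δ : ℝ} {h : ℕ → ℝ → ℝ}
    (hd : ∀ k, ∀ t ∈ Ioo (-δ) δ, HasDerivAt (h k) (h (k + 1) t) t)
    (S : Finset ι) (c w : ι → ℝ) (hc : ∀ i ∈ S, |c i| < 1)
    (hrel : ∀ t ∈ Ioo (-δ) δ, h 0 t = ∑ i ∈ S, w i * h 0 (c i * t)) (k : ℕ) :
    ∀ t ∈ Ioo (-δ) δ, h k t = ∑ i ∈ S, w i * c i ^ k * h k (c i * t) := by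
  have hmem : ∀ i ∈ S, ∀ t ∈ Ioo (-δ) δ, c i * t ∈ Ioo (-δ) δ := by
    intro i hi t ht
    have ht' : |t| < δ := abs_lt.2 ht
    refine abs_lt.1 ?_
    rw [abs_mul]
    exact (mul_le_of_le_one_left (abs_nonneg t) (hc i hi).le).trans_lt ht'
  induction k with
  | zero => simpa using hrel
  | succ k ih =>
    intro t ht
    have h1 := hd k t ht
    have h2 : HasDerivAt (fun s => ∑ i ∈ S, w i * c i ^ k * h k (c i * s))
        (∑ i ∈ S, w i * c i ^ k * (h (k + 1) (c i * t) * (c i * 1))) t := by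
      refine HasDerivAt.fun_sum fun i hi => ?_
      refine HasDerivAt.const_mul _ ?_
      exact (hd k (c i * t) (hmem i hi t ht)).comp t ((hasDerivAt_id t).const_mul (c i))
    have h3 : h k =ᶠ[nhds t] fun s => ∑ i ∈ S, w i * c i ^ k * h k (c i * s) :=
      Filter.eventually_of_mem (isOpen_Ioo.mem_nhds ht) ih
    rw [h1.unique (h2.congr_of_eventuallyEq h3)]
    refine Finset.sum_congr rfl fun i _ => ?_
    ring

/-- A function which is a linear combination of strict contractions of itself is locally
annihilated by a derivative of high order: the `k`-th derivative satisfies the same relation with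
the weights multiplied by `c i ^ k`, which eventually makes the relation contracting in the
supremum norm. -/
lemma exists_iterate_deriv_eq_zero {ι : Type*} {δ : ℝ} (hδ : 0 < δ) {h : ℕ → ℝ → ℝ}
    (hd : ∀ k, ∀ t ∈ Ioo (-δ) δ, HasDerivAt (h k) (h (k + 1) t) t)
    (S : Finset ι) (c w : ι → ℝ) (hc : ∀ i ∈ S, |c i| < 1)
    (hrel : ∀ t ∈ Ioo (-δ) δ, h 0 t = ∑ i ∈ S, w i * h 0 (c i * t)) :
    ∃ K, ∀ t ∈ Ioo (-(δ / 2)) (δ / 2), h K t = 0 := by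
  have hlim : Filter.Tendsto (fun k : ℕ => ∑ i ∈ S, |w i| * |c i| ^ k) Filter.atTop (nhds 0) := by
    have : Filter.Tendsto (fun k : ℕ => ∑ i ∈ S, |w i| * |c i| ^ k) Filter.atTop
        (nhds (∑ i ∈ S, |w i| * 0)) :=
      tendsto_finsetSum _ fun i hi =>
        (tendsto_pow_atTop_nhds_zero_of_lt_one (abs_nonneg _) (hc i hi)).const_mul _
    simpa using this
  obtain ⟨K, hK⟩ := (hlim.eventually (gt_mem_nhds zero_lt_one)).exists
  refine ⟨K, ?_⟩
  have hsub : Icc (-(δ / 2)) (δ / 2) ⊆ Ioo (-δ) δ := fun t ht =>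
    ⟨by linarith [ht.1], by linarith [ht.2]⟩
  have hcont : ContinuousOn (fun t => |h K t|) (Icc (-(δ / 2)) (δ / 2)) := fun t ht =>
    ((hd K t (hsub ht)).continuousAt.abs).continuousWithinAt
  obtain ⟨s, hs, hmax⟩ := isCompact_Icc.exists_isMaxOn
    (nonempty_Icc.2 (by linarith : -(δ / 2) ≤ δ / 2)) hcont
  have hle : |h K s| ≤ (∑ i ∈ S, |w i| * |c i| ^ K) * |h K s| := by
    conv_lhs => rw [sum_mul_pow_mul_iterate_deriv_eq hd S c w hc hrel K s (hsub hs)]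
    refine (Finset.abs_sum_le_sum_abs _ _).trans ?_
    rw [Finset.sum_mul]
    refine Finset.sum_le_sum fun i hi => ?_
    rw [abs_mul, abs_mul, abs_pow]
    refine mul_le_mul_of_nonneg_left ?_ (by positivity)
    refine hmax (abs_le.1 ?_)
    rw [abs_mul]
    exact (mul_le_of_le_one_left (abs_nonneg s) (hc i hi).le).trans (abs_le.2 hs)
  have hzero : |h K s| = 0 := by
    by_contra hne
    have hpos : 0 < |h K s| := lt_of_le_of_ne (abs_nonneg _) (Ne.symm hne)
    nlinarith
  intro t ht
  have : |h K t| ≤ |h K s| := hmax (Ioo_subset_Icc_self ht)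
  rw [hzero] at this
  exact abs_nonpos_iff.1 this

lemma Polynomial.exists_derivative_eq (p : Polynomial ℝ) :
    ∃ q : Polynomial ℝ, Polynomial.derivative q = p := by
  induction p using Polynomial.induction_on' with
  | add p q hp hq =>
    obtain ⟨p', rfl⟩ := hp
    obtain ⟨q', rfl⟩ := hq
    exact ⟨p' + q', by simp⟩
  | monomial n a =>
    refine ⟨Polynomial.monomial (n + 1) (a / (n + 1)), ?_⟩
    rw [Polynomial.derivative_monomial]
    congr 1
    push_cast
    field_simp

lemma exists_polynomial_of_iterate_deriv_eq_zero {δ : ℝ} (K : ℕ) :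
    ∀ h : ℕ → ℝ → ℝ, (∀ k, ∀ t ∈ Ioo (-δ) δ, HasDerivAt (h k) (h (k + 1) t) t) →
    (∀ t ∈ Ioo (-δ) δ, h K t = 0) →
    ∃ p : Polynomial ℝ, ∀ t ∈ Ioo (-δ) δ, h 0 t = p.eval t := by
  induction K with
  | zero => intro h _ h0; exact ⟨0, by simpa using h0⟩
  | succ K ih =>
    intro h hd h0
    obtain ⟨p, hp⟩ := ih (fun k => h (k + 1)) (fun k => hd (k + 1)) h0
    obtain ⟨q, rfl⟩ := Polynomial.exists_derivative_eq p
    by_cases hδ : 0 < δ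
    · have h0mem : (0 : ℝ) ∈ Ioo (-δ) δ := ⟨by linarith, hδ⟩
      refine ⟨q + Polynomial.C (h 0 0 - q.eval 0), fun t ht => ?_⟩
      have hD : ∀ s ∈ Ioo (-δ) δ, HasDerivAt (fun s => h 0 s - q.eval s) 0 s := by
        intro s hs
        have := (hd 0 s hs).sub (q.hasDerivAt s)
        rwa [hp s hs, sub_self] at this
      have := isOpen_Ioo.is_const_of_deriv_eq_zero (isPreconnected_Ioo)
        (fun s hs => (hD s hs).differentiableAt.differentiableWithinAt)
        (fun s hs => (hD s hs).deriv) ht h0mem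
      simp only [Polynomial.eval_add, Polynomial.eval_C]
      linarith
    · exact ⟨0, fun t ht => absurd (ht.1.trans ht.2) (by linarith)⟩

/-- Two families with the same number of occurrences of each value differ by a permutation. -/
lemma exists_perm_of_card_fiber_eq {ι : Type*} [Fintype ι] [DecidableEq ι] {a b : ι → ℝ}
    (h : ∀ v, Fintype.card {i // a i = v} = Fintype.card {i // b i = v}) :
    ∃ σ : Equiv.Perm ι, ∀ i, a i = b (σ i) := by
  refine ⟨Equiv.ofFiberEquiv fun v => Fintype.equivOfCardEq (h v), fun i => ?_⟩
  exact (Equiv.ofFiberEquiv_map _ i).symm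

/-- Either the families `a` and `b` of nonnegative dilation factors agree up to order, or a smooth
solution `g = h 0` of the equation `∑ g (a i * t) = ∑ g (b i * t)` is a polynomial near `0`. -/
lemma exists_perm_or_polynomial_of_sum_dilate_eq {ι : Type*} [Fintype ι] {δ : ℝ} (hδ : 0 < δ)
    {h : ℕ → ℝ → ℝ} (hd : ∀ k, ∀ t ∈ Ioo (-δ) δ, HasDerivAt (h k) (h (k + 1) t) t)
    {a b : ι → ℝ} (ha : ∀ i, 0 ≤ a i) (hb : ∀ i, 0 ≤ b i)
    (hrel : ∀ t, (∀ i, a i * t ∈ Ioo (-δ) δ) → (∀ i, b i * t ∈ Ioo (-δ) δ) →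
      ∑ i, h 0 (a i * t) = ∑ i, h 0 (b i * t)) :
    (∃ σ : Equiv.Perm ι, ∀ i, a i = b (σ i)) ∨
      ∃ p : Polynomial ℝ, ∃ η > 0, ∀ t ∈ Ioo (-η) η, h 0 t = p.eval t := by
  classical
  -- `n v` is the difference of the multiplicities of the value `v` in the two families.
  let n : ℝ → ℝ := fun v =>
    (Finset.univ.filter fun i => a i = v).card - (Finset.univ.filter fun i => b i = v).card
  let S : Finset ℝ := Finset.univ.image a ∪ Finset.univ.image b
  have haS : ∀ i ∈ Finset.univ, a i ∈ S := fun i _ =>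
    Finset.mem_union_left _ (Finset.mem_image_of_mem _ (Finset.mem_univ i))
  have hbS : ∀ i ∈ Finset.univ, b i ∈ S := fun i _ =>
    Finset.mem_union_right _ (Finset.mem_image_of_mem _ (Finset.mem_univ i))
  have hSnonneg : ∀ v ∈ S, 0 ≤ v := by
    intro v hv
    simp only [S, Finset.mem_union, Finset.mem_image, Finset.mem_univ, true_and] at hv
    rcases hv with ⟨i, rfl⟩ | ⟨i, rfl⟩
    exacts [ha i, hb i]
  have hsum : ∀ F : ℝ → ℝ, ∑ v ∈ S, n v * F v = ∑ i, F (a i) - ∑ i, F (b i) := by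
    intro F
    have key : ∀ e : ι → ℝ, (∀ i ∈ Finset.univ, e i ∈ S) →
        ∑ v ∈ S, ((Finset.univ.filter fun i => e i = v).card : ℝ) * F v = ∑ i, F (e i) := by
      intro e he
      rw [← Finset.sum_fiberwise_of_maps_to he]
      refine Finset.sum_congr rfl fun v _ => ?_
      rw [Finset.sum_congr rfl (g := fun _ => F v)]
      · simp
      · intro i hi
        rw [(Finset.mem_filter.1 hi).2]
    simp only [n, sub_mul, Finset.sum_sub_distrib]
    rw [key a haS, key b hbS]
  have hn_out : ∀ v, v ∉ S → n v = 0 := by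
    intro v hv
    have h1 : (Finset.univ.filter fun i => a i = v) = ∅ :=
      Finset.filter_eq_empty_iff.2 fun i hi hiv => hv (hiv ▸ haS i hi)
    have h2 : (Finset.univ.filter fun i => b i = v) = ∅ :=
      Finset.filter_eq_empty_iff.2 fun i hi hiv => hv (hiv ▸ hbS i hi)
    simp [n, h1, h2]
  by_cases hall : ∀ v ∈ S, 0 < v → n v = 0
  · -- The multiplicities of `0` agree because both families have the same cardinality.
    left
    have htot : ∑ v ∈ S, n v = 0 := by simpa using hsum fun _ => 1
    have hn0 : n 0 = 0 := by
      by_cases h0 : (0 : ℝ) ∈ S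
      · rwa [Finset.sum_eq_single_of_mem 0 h0 fun v hv hv0 =>
          hall v hv (lt_of_le_of_ne (hSnonneg v hv) (Ne.symm hv0))] at htot
      · exact hn_out 0 h0
    refine exists_perm_of_card_fiber_eq fun v => ?_
    have hv : n v = 0 := by
      by_cases hvS : v ∈ S
      · rcases (hSnonneg v hvS).eq_or_lt with rfl | hpos
        exacts [hn0, hall v hvS hpos]
      · exact hn_out v hvS
    rw [Fintype.card_subtype, Fintype.card_subtype]
    exact_mod_cast sub_eq_zero.1 hv
  · right
    push Not at hall
    obtain ⟨v₀, hv₀S, hv₀pos, hv₀n⟩ := hall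
    let T := S.filter fun v => n v ≠ 0
    have hTne : T.Nonempty := ⟨v₀, Finset.mem_filter.2 ⟨hv₀S, hv₀n⟩⟩
    -- `m` is the largest factor that does not cancel.
    set m := T.max' hTne with hm
    have hmT : m ∈ T := T.max'_mem hTne
    have hmn : n m ≠ 0 := (Finset.mem_filter.1 hmT).2
    have hmpos : 0 < m := hv₀pos.trans_le (T.le_max' v₀ (Finset.mem_filter.2 ⟨hv₀S, hv₀n⟩))
    -- All dilates by factors in `S` of points of the interval of radius `η` stay in the domain.
    obtain ⟨B, hB1, hB⟩ : ∃ B : ℝ, m ≤ B ∧ ∀ v ∈ S, v ≤ B := by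
      obtain ⟨B, hB⟩ := S.finite_toSet.bddAbove
      exact ⟨max m B, le_max_left _ _, fun v hv => (hB hv).trans (le_max_right _ _)⟩
    have hBpos : 0 < B := hmpos.trans_le hB1
    let η := m * (δ / B)
    have hηpos : 0 < η := by positivity
    have hηδ : η ≤ δ := by
      have : m / B ≤ 1 := (div_le_one hBpos).2 hB1
      calc η = m / B * δ := by simp only [η]; ring
        _ ≤ 1 * δ := by gcongr
        _ = δ := one_mul δ
    have hd' : ∀ k, ∀ t ∈ Ioo (-η) η, HasDerivAt (h k) (h (k + 1) t) t := fun k t ht =>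
      hd k t ⟨by linarith [ht.1], by linarith [ht.2]⟩
    have hmem : ∀ v ∈ S, ∀ t ∈ Ioo (-η) η, v * (t / m) ∈ Ioo (-δ) δ := by
      intro v hv t ht
      refine abs_lt.1 ?_
      have ht' : |t| < η := abs_lt.2 ht
      have h1 : |t / m| < δ / B := by
        rw [abs_div, abs_of_pos hmpos, div_lt_iff₀ hmpos, mul_comm]
        exact ht'
      rw [abs_mul, abs_of_nonneg (hSnonneg v hv)]
      calc v * |t / m| ≤ B * |t / m| := by gcongr; exact hB v hv
        _ < B * (δ / B) := by gcongr
        _ = δ := by field_simp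
    obtain ⟨K, hK⟩ := exists_iterate_deriv_eq_zero hηpos hd' (T.erase m) (fun v => v / m)
      (fun v => -(n v / n m)) (by
        intro v hv
        have hvT := Finset.mem_of_mem_erase hv
        have hvS := (Finset.mem_filter.1 hvT).1
        rw [abs_of_nonneg (div_nonneg (hSnonneg v hvS) hmpos.le), div_lt_one hmpos]
        exact lt_of_le_of_ne (T.le_max' v hvT) (Finset.ne_of_mem_erase hv)) (by
        intro t ht
        have h1 := hsum fun v => h 0 (v * (t / m))
        rw [hrel (t / m) (fun i => hmem _ (haS i (Finset.mem_univ i)) t ht)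
          (fun i => hmem _ (hbS i (Finset.mem_univ i)) t ht), sub_self] at h1
        have h2 : ∑ v ∈ T, n v * h 0 (v * (t / m)) = 0 := by
          rw [← h1]
          refine Finset.sum_subset (Finset.filter_subset _ _) fun v hv hvT => ?_
          have : n v = 0 := by
            by_contra hne
            exact hvT (Finset.mem_filter.2 ⟨hv, hne⟩)
          rw [this, zero_mul]
        rw [← Finset.add_sum_erase T _ hmT, mul_div_cancel₀ t hmpos.ne'] at h2
        have h3 : ∑ v ∈ T.erase m, -(n v / n m) * h 0 (v / m * t)
            = -(∑ v ∈ T.erase m, n v * h 0 (v * (t / m))) / n m := by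
          rw [← Finset.sum_neg_distrib, Finset.sum_div]
          refine Finset.sum_congr rfl fun v _ => ?_
          rw [show v / m * t = v * (t / m) by ring]
          ring
        rw [h3, eq_div_iff hmn]
        linarith)
    obtain ⟨p, hp⟩ := exists_polynomial_of_iterate_deriv_eq_zero K h
      (fun k t ht => hd' k t ⟨by linarith [ht.1], by linarith [ht.2]⟩) hK
    exact ⟨p, η / 2, by positivity, hp⟩

/-! ### Entire functions whose real part has polynomial growth -/

lemma Polynomial.exists_norm_eval_le (p : Polynomial ℂ) :
    ∃ C : ℝ, 0 ≤ C ∧ ∃ n : ℕ, ∀ z : ℂ, ‖p.eval z‖ ≤ C * (1 + ‖z‖) ^ n := by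
  refine ⟨∑ i ∈ Finset.range (p.natDegree + 1), ‖p.coeff i‖, by positivity, p.natDegree,
    fun z => ?_⟩
  rw [Polynomial.eval_eq_sum_range, Finset.sum_mul]
  refine (norm_sum_le _ _).trans (Finset.sum_le_sum fun i hi => ?_)
  rw [norm_mul, norm_pow]
  refine mul_le_mul_of_nonneg_left ?_ (norm_nonneg _)
  have h1 : ‖z‖ ≤ 1 + ‖z‖ := by linarith
  calc ‖z‖ ^ i ≤ (1 + ‖z‖) ^ i := by gcongr
    _ ≤ (1 + ‖z‖) ^ p.natDegree :=
      pow_le_pow_right₀ (by linarith [norm_nonneg z]) (Nat.lt_succ_iff.1 (Finset.mem_range.1 hi))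

/-- A Liouville theorem: an entire function whose real part has at most polynomial growth is a
polynomial. The Borel–Carathéodory theorem bounds the function itself, and Cauchy's estimates
kill its high Taylor coefficients. -/
lemma exists_polynomial_of_differentiable_of_re_le {Q : ℂ → ℂ} (hQ : Differentiable ℂ Q) {C : ℝ}
    (hC : 0 ≤ C) {n : ℕ} (hre : ∀ z, (Q z).re ≤ C * (1 + ‖z‖) ^ n) :
    ∃ P : Polynomial ℂ, ∀ z, Q z = P.eval z := by
  -- Apply Borel–Carathéodory on the ball of radius `2 * r`, where `1 + ‖w‖ ≤ 3 * r` as `r ≥ 1`.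
  have hbound : ∀ r : ℝ, 1 ≤ r → ∀ z ∈ Metric.sphere (0 : ℂ) r,
      ‖Q z‖ ≤ (2 * (C * 3 ^ n + 1) + 3 * ‖Q 0‖) * r ^ n := by
    intro r hr z hz
    have hz' : ‖z‖ = r := mem_sphere_zero_iff_norm.1 hz
    have hr0 : 0 < r := by linarith
    have hM : 0 < C * (3 * r) ^ n + 1 := by positivity
    have h := Complex.borelCaratheodory (f := Q) (R := 2 * r) (z := z) hM hQ.differentiableOn
      (fun w hw => by
        have hw' : ‖w‖ < 2 * r := mem_ball_zero_iff.1 hw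
        have : (Q w).re ≤ C * (3 * r) ^ n := by
          refine (hre w).trans ?_
          gcongr
          linarith
        exact this.trans (by linarith)) (by linarith) (mem_ball_zero_iff.2 (by linarith))
    rw [hz'] at h
    have h2 : 2 * (C * (3 * r) ^ n + 1) * r / (2 * r - r) + ‖Q 0‖ * (2 * r + r) / (2 * r - r)
        = 2 * (C * (3 * r) ^ n + 1) + 3 * ‖Q 0‖ := by
      have : 2 * r - r = r := by ring
      rw [this]
      field_simp
      ring
    rw [h2] at h
    have hrn : 1 ≤ r ^ n := one_le_pow₀ hr
    have h3 : (1 : ℝ) * 2 ≤ r ^ n * 2 := by gcongr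
    have h4 : ‖Q 0‖ * 1 ≤ ‖Q 0‖ * r ^ n := by gcongr
    rw [mul_pow] at h
    nlinarith
  have hzero : ∀ k, n < k → iteratedDeriv k Q 0 = 0 := by
    intro k hk
    have hlim : Filter.Tendsto (fun r : ℝ => (k.factorial : ℝ) *
        ((2 * (C * 3 ^ n + 1) + 3 * ‖Q 0‖) * (r ^ n / r ^ k))) Filter.atTop (nhds 0) := by
      have := ((tendsto_pow_div_pow_atTop_zero (𝕜 := ℝ) hk).const_mul
        (2 * (C * 3 ^ n + 1) + 3 * ‖Q 0‖)).const_mul (k.factorial : ℝ)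
      simpa using this
    refine norm_le_zero_iff.1 (ge_of_tendsto hlim ?_)
    filter_upwards [Filter.eventually_ge_atTop 1] with r hr
    have := Complex.norm_iteratedDeriv_le_of_forall_mem_sphere_norm_le (c := 0) k
      (by linarith : (0 : ℝ) < r) hQ.diffContOnCl (hbound r hr)
    refine this.trans (le_of_eq ?_)
    ring
  refine ⟨∑ k ∈ Finset.range (n + 1),
    Polynomial.monomial k ((k.factorial : ℂ)⁻¹ * iteratedDeriv k Q 0), fun z => ?_⟩
  rw [← Complex.taylorSeries_eq_of_entire' 0 z hQ, tsum_eq_sum (s := Finset.range (n + 1)),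
    Polynomial.eval_finsetSum]
  · simp
  · intro k hk
    rw [hzero k (by simpa using hk)]
    simp

/-- Marcinkiewicz: if the real part of a polynomial is maximal on the real axis along every
vertical line, then the polynomial is at most quadratic. Otherwise, in the limit of large radii,
the leading monomial `a z ^ n` satisfies the same inequality, which fails in one of the `n ≥ 3`
directions where `a z ^ n` is positive. -/
lemma Polynomial.natDegree_le_two_of_re_le (P : Polynomial ℂ)
    (h : ∀ z : ℂ, (P.eval z).re ≤ (P.eval (z.re : ℂ)).re) : P.natDegree ≤ 2 := by
  by_contra! hn
  set n := P.natDegree with hn_def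
  set a := P.leadingCoeff with ha_def
  have ha : a ≠ 0 := by
    intro h0
    rw [ha_def, Polynomial.leadingCoeff_eq_zero] at h0
    simp [hn_def, h0] at hn
  have hlim : ∀ w : ℂ, Filter.Tendsto (fun r : ℝ => P.eval ((r : ℂ) * w) / (r : ℂ) ^ n)
      Filter.atTop (nhds (a * w ^ n)) := by
    intro w
    have h1 : ∀ i ∈ Finset.range (n + 1), Filter.Tendsto
        (fun r : ℝ => P.coeff i * w ^ i * (((r ^ i / r ^ n : ℝ)) : ℂ)) Filter.atTop
        (nhds (if i = n then a * w ^ n else 0)) := by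
      intro i hi
      split_ifs with hin
      · subst hin
        refine Filter.Tendsto.congr' ?_ tendsto_const_nhds
        filter_upwards [Filter.eventually_gt_atTop 0] with r hr
        rw [div_self (pow_pos hr _).ne']
        rw [ha_def, hn_def, Complex.ofReal_one, mul_one, Polynomial.coeff_natDegree]
      · have hlt : i < n := lt_of_le_of_ne (Nat.lt_succ_iff.1 (Finset.mem_range.1 hi)) hin
        have := (Complex.continuous_ofReal.tendsto 0).comp
          (tendsto_pow_div_pow_atTop_zero (𝕜 := ℝ) hlt)
        simpa using this.const_mul (P.coeff i * w ^ i)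
    have h2 := tendsto_finsetSum (Finset.range (n + 1)) h1
    rw [Finset.sum_ite_eq' (Finset.range (n + 1)) n, if_pos (by simp)] at h2
    refine h2.congr fun r => ?_
    rw [Polynomial.eval_eq_sum_range, Finset.sum_div]
    refine Finset.sum_congr rfl fun i _ => ?_
    push_cast
    ring
  have hlead : ∀ w : ℂ, (a * w ^ n).re ≤ (a * (w.re : ℂ) ^ n).re := by
    intro w
    refine le_of_tendsto_of_tendsto ((Complex.continuous_re.tendsto _).comp (hlim w))
      ((Complex.continuous_re.tendsto _).comp (hlim (w.re : ℂ))) ?_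
    filter_upwards [Filter.eventually_gt_atTop 0] with r hr
    have h1 := h ((r : ℂ) * w)
    simp only [Function.comp_apply]
    rw [← Complex.ofReal_pow, Complex.div_ofReal_re, Complex.div_ofReal_re]
    have h2 : (((r : ℂ) * w).re : ℂ) = (r : ℂ) * (w.re : ℂ) := by simp
    rw [h2] at h1
    gcongr
  -- In the direction of angle `θ` with `a * exp (I * n * θ) = ‖a‖` the sine must vanish.
  have hsin : ∀ θ : ℝ, a * Complex.exp (θ * Complex.I) ^ n = ‖a‖ → Real.sin θ = 0 := by
    intro θ hθ
    have h1 := hlead (Complex.exp (θ * Complex.I))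
    rw [hθ, Complex.ofReal_re, Complex.exp_ofReal_mul_I_re, ← Complex.ofReal_pow,
      Complex.re_mul_ofReal] at h1
    have h2 : a.re * Real.cos θ ^ n ≤ ‖a‖ * |Real.cos θ| ^ n := by
      refine (le_abs_self _).trans ?_
      rw [abs_mul, abs_pow]
      gcongr
      exact Complex.abs_re_le_norm a
    have hapos : 0 < ‖a‖ := norm_pos_iff.2 ha
    have h3 : 1 ≤ |Real.cos θ| ^ n := by
      by_contra! hlt
      nlinarith
    have h4 : |Real.cos θ| = 1 := by
      refine le_antisymm (Real.abs_cos_le_one θ) ?_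
      by_contra! hlt
      exact absurd (pow_lt_one₀ (abs_nonneg _) hlt (by omega : n ≠ 0)) (not_lt.2 h3)
    have h5 : Real.cos θ ^ 2 = 1 := by rw [← sq_abs, h4, one_pow]
    have h6 := Real.sin_sq_add_cos_sq θ
    exact pow_eq_zero_iff two_ne_zero |>.1 (by linarith)
  have hn0 : (n : ℝ) ≠ 0 := by
    have : 0 < n := by omega
    exact_mod_cast this.ne'
  have hn0' : (n : ℂ) ≠ 0 := by exact_mod_cast hn0
  have hdir : ∀ k : ℕ, Real.sin ((-a.arg + k * (2 * Real.pi)) / n) = 0 := by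
    intro k
    refine hsin _ ?_
    rw [← Complex.exp_nat_mul]
    have h1 : (n : ℂ) * ((((-a.arg + k * (2 * Real.pi)) / n : ℝ) : ℂ) * Complex.I)
        = -(a.arg * Complex.I) + k * (2 * Real.pi * Complex.I) := by
      push_cast
      field_simp
    rw [h1, Complex.exp_add, Complex.exp_nat_mul_two_pi_mul_I, mul_one, Complex.exp_neg]
    rw [mul_inv_eq_iff_eq_mul₀ (Complex.exp_ne_zero _), Complex.norm_mul_exp_arg_mul_I]
  have h0 := hdir 0
  have h1 := hdir 1
  simp only [Nat.cast_zero, zero_mul, add_zero, Nat.cast_one, one_mul] at h0 h1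
  rw [add_div, Real.sin_add, h0, zero_mul, zero_add] at h1
  have h3n : (3 : ℝ) ≤ n := by exact_mod_cast hn
  have hs : 0 < Real.sin (2 * Real.pi / n) := by
    refine Real.sin_pos_of_pos_of_lt_pi (by positivity) ?_
    rw [div_lt_iff₀ (by positivity)]
    nlinarith [Real.pi_pos]
  have hcos : Real.cos (-a.arg / n) = 0 := (mul_eq_zero.1 h1).resolve_right hs.ne'
  have := Real.sin_sq_add_cos_sq (-a.arg / n)
  rw [h0, hcos] at this
  norm_num at this

/-- An entire function without zeros is the exponential of an entire function. -/
lemma exists_eq_exp_of_differentiable {M : ℂ → ℂ} (hM : Differentiable ℂ M) (h0 : ∀ z, M z ≠ 0) :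
    ∃ Q : ℂ → ℂ, Differentiable ℂ Q ∧ ∀ z, M z = Complex.exp (Q z) := by
  have hM' : Differentiable ℂ (deriv M) := fun z =>
    (hM.differentiableOn.deriv isOpen_univ).differentiableAt Filter.univ_mem
  obtain ⟨q, hq⟩ := (hM'.div hM h0).isExactOn_univ
  have hconst : ∀ z, M z * Complex.exp (-q z) = M 0 * Complex.exp (-q 0) := by
    have hder : ∀ z, HasDerivAt (fun z => M z * Complex.exp (-q z)) 0 z := by
      intro z
      have h1 := (hM z).hasDerivAt.mul (hq z (mem_univ z)).neg.cexp
      convert! h1 using 1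
      have := h0 z
      simp only [Pi.div_apply]
      field_simp
      ring
    exact fun z => is_const_of_deriv_eq_zero (fun z => (hder z).differentiableAt)
      (fun z => (hder z).deriv) z 0
  refine ⟨fun z => q z + (Complex.log (M 0) - q 0), fun z =>
    (hq z (mem_univ z)).differentiableAt.add_const _, fun z => ?_⟩
  have h2 := hconst z
  rw [Complex.exp_neg, Complex.exp_neg] at h2
  rw [Complex.exp_add, Complex.exp_sub, Complex.exp_log (h0 0)]
  have h3 := Complex.exp_ne_zero (q z)
  have h4 := Complex.exp_ne_zero (q 0)
  field_simp at h2 ⊢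
  exact h2

/-! ### Exponential moments and a characterization of Gaussian laws -/

lemma iteratedDeriv_comp_ofReal {F : ℂ → ℂ} (hF : Differentiable ℂ F) (n : ℕ) (t : ℝ) :
    iteratedDeriv n (fun s : ℝ => F s) t = iteratedDeriv n F t := by
  induction n generalizing t with
  | zero => simp
  | succ n ih =>
    rw [iteratedDeriv_succ, iteratedDeriv_succ, funext ih]
    have hd : Differentiable ℂ (iteratedDeriv n F) :=
      ContDiff.differentiable_iteratedDeriv n (hF.contDiff (n := (n + 1 : ℕ)))
        (by exact_mod_cast Nat.lt_succ_self n)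
    exact ((hd t).hasDerivAt.comp_ofReal).deriv

/-- If a characteristic function coincides near `0` with an entire function, then all exponential
moments are finite: Cauchy's estimates bound the even moments, hence the integrals of the
hyperbolic cosines. -/
lemma integrable_exp_mul_of_charFun_eq {ν : Measure ℝ} [IsProbabilityMeasure ν]
    (hν : ∀ k : ℕ, MemLp id k ν) {F : ℂ → ℂ} (hF : Differentiable ℂ F)
    (hcf : charFun ν =ᶠ[nhds 0] fun t : ℝ => F t) (t : ℝ) :
    Integrable (fun x => Real.exp (t * x)) ν := by
  obtain ⟨R, hR⟩ : ∃ R : ℝ, R = |t| + 1 := ⟨_, rfl⟩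
  have hRpos : 0 < R := by rw [hR]; positivity
  obtain ⟨C, hC⟩ := (isCompact_sphere (0 : ℂ) R).exists_bound_of_continuousOn
    hF.continuous.continuousOn
  have hmom : ∀ k : ℕ, ‖∫ x, x ^ (2 * k) ∂ν‖ ≤ (2 * k).factorial * C / R ^ (2 * k) := by
    intro k
    have h1 := Complex.norm_iteratedDeriv_le_of_forall_mem_sphere_norm_le (2 * k) hRpos
      hF.diffContOnCl hC
    have h2 := iteratedDeriv_charFun_zero (hν (2 * k))
    rw [(hcf.iteratedDeriv_eq (2 * k)), iteratedDeriv_comp_ofReal hF, Complex.ofReal_zero] at h2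
    rw [h2] at h1
    simpa using h1
  have hint : ∀ k : ℕ, Integrable (fun x : ℝ => x ^ (2 * k)) ν := fun k => by
    simpa [(even_two_mul k).pow_abs] using (hν (2 * k)).integrable_norm_pow'
  have hnonneg : ∀ (k : ℕ) (x : ℝ), 0 ≤ (t * x) ^ (2 * k) / (2 * k).factorial := fun k x => by
    have : 0 ≤ (t * x) ^ (2 * k) := (even_two_mul k).pow_nonneg _
    positivity
  have hle : ∀ k : ℕ, ∫ x, (t * x) ^ (2 * k) / (2 * k).factorial ∂ν
      ≤ C * ((t / R) ^ 2) ^ k := by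
    intro k
    have h1 : ∫ x, (t * x) ^ (2 * k) / (2 * k).factorial ∂ν
        = t ^ (2 * k) / (2 * k).factorial * ∫ x, x ^ (2 * k) ∂ν := by
      rw [← integral_const_mul]
      congr 1 with x
      rw [mul_pow]
      ring
    have ht : 0 ≤ t ^ (2 * k) := (even_two_mul k).pow_nonneg _
    have h2 := (le_abs_self _).trans (hmom k)
    rw [h1]
    calc t ^ (2 * k) / (2 * k).factorial * ∫ x, x ^ (2 * k) ∂ν
        ≤ t ^ (2 * k) / (2 * k).factorial * ((2 * k).factorial * C / R ^ (2 * k)) := by gcongr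
      _ = C * ((t / R) ^ 2) ^ k := by
        have : ((2 * k).factorial : ℝ) ≠ 0 := by positivity
        rw [← pow_mul, div_pow]
        field_simp
  have hratio : (t / R) ^ 2 < 1 := by
    rw [sq_lt_one_iff_abs_lt_one, abs_div, abs_of_pos hRpos, div_lt_one hRpos, hR]
    linarith
  have hsummable : Summable fun k : ℕ => C * ((t / R) ^ 2) ^ k :=
    (summable_geometric_of_lt_one (sq_nonneg _) hratio).mul_left C
  have hcosh : ∫⁻ x, ENNReal.ofReal (Real.cosh (t * x)) ∂ν < ⊤ := by
    have h1 : ∀ x : ℝ, ENNReal.ofReal (Real.cosh (t * x))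
        = ∑' k : ℕ, ENNReal.ofReal ((t * x) ^ (2 * k) / (2 * k).factorial) := fun x => by
      rw [Real.cosh_eq_tsum, ENNReal.ofReal_tsum_of_nonneg (fun k => hnonneg k x)
        (Real.hasSum_cosh _).summable]
    simp_rw [h1]
    rw [lintegral_tsum fun k => by fun_prop]
    have h2 : ∀ k : ℕ, ∫⁻ x, ENNReal.ofReal ((t * x) ^ (2 * k) / (2 * k).factorial) ∂ν
        ≤ ENNReal.ofReal (C * ((t / R) ^ 2) ^ k) := by
      intro k
      rw [← ofReal_integral_eq_lintegral_ofReal _ (Filter.Eventually.of_forall (hnonneg k))]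
      · exact ENNReal.ofReal_le_ofReal (hle k)
      · simp_rw [mul_pow]
        exact ((hint k).const_mul _).div_const _
    refine (ENNReal.tsum_le_tsum h2).trans_lt ?_
    exact hsummable.tsum_ofReal_lt_top
  have hI : Integrable (fun x => Real.cosh (t * x)) ν := by
    refine ⟨by fun_prop, ?_⟩
    rw [hasFiniteIntegral_iff_ofReal (Filter.Eventually.of_forall fun x => (Real.cosh_pos _).le)]
    exact hcosh
  refine (hI.const_mul 2).mono' (by fun_prop) (Filter.Eventually.of_forall fun x => ?_)
  rw [Real.norm_of_nonneg (Real.exp_pos _).le, Real.cosh_eq]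
  linarith [Real.exp_pos (-(t * x))]

/-- If `‖φ‖²` coincides near `0` with an entire function, `φ` being the characteristic function
of `μ`, then `μ` has all exponential moments: `‖φ‖²` is the characteristic function of the
difference of two independent variables with law `μ`, and exponential moments of such a difference
yield those of `μ` by Fubini's theorem. -/
lemma integrable_exp_mul_of_norm_sq_charFun_eq {μ : Measure ℝ} [IsProbabilityMeasure μ]
    (hμ : ∀ k : ℕ, MemLp id k μ) {F : ℂ → ℂ} (hF : Differentiable ℂ F)
    (hcf : (fun t => ((‖charFun μ t‖ ^ 2 : ℝ) : ℂ)) =ᶠ[nhds 0] fun t : ℝ => F t) (t : ℝ) :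
    Integrable (fun x => Real.exp (t * x)) μ := by
  have : IsProbabilityMeasure (μ.map fun x : ℝ => -x) :=
    Measure.isProbabilityMeasure_map measurable_neg.aemeasurable
  have hneg : ∀ k : ℕ, MemLp id k (μ.map fun x : ℝ => -x) := fun k => by
    rw [memLp_map_measure_iff aestronglyMeasurable_id measurable_neg.aemeasurable]
    exact (hμ k).neg
  let ν := μ.conv (μ.map fun x : ℝ => -x)
  have hν : ∀ k : ℕ, MemLp id k ν := fun k => by
    have h1 : MemLp (fun p : ℝ × ℝ => p.1 + p.2) k (μ.prod (μ.map fun x : ℝ => -x)) :=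
      ((hμ k).comp_fst _).add ((hneg k).comp_snd _)
    exact (memLp_map_measure_iff aestronglyMeasurable_id (by fun_prop)).2 h1
  have hcharneg : ∀ s, charFun (μ.map fun x : ℝ => -x) s = charFun μ (-s) := fun s => by
    have := charFun_map_mul (μ := μ) (-1) s
    simpa using this
  have hcharν : charFun ν = fun s => ((‖charFun μ s‖ ^ 2 : ℝ) : ℂ) := by
    ext s
    rw [charFun_conv, hcharneg, charFun_neg, Complex.mul_conj, Complex.normSq_eq_norm_sq]
  have h1 : Integrable (fun x => Real.exp (t * x)) ν :=
    integrable_exp_mul_of_charFun_eq hν hF (by rw [hcharν]; exact hcf) t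
  have h2 : Integrable (fun p : ℝ × ℝ => Real.exp (t * (p.1 + p.2)))
      (μ.prod (μ.map fun x : ℝ => -x)) :=
    (integrable_map_measure (g := fun x : ℝ => Real.exp (t * x)) (by fun_prop)
      (by fun_prop)).1 h1
  obtain ⟨y, hy⟩ := h2.prod_left_ae.exists
  refine (hy.mul_const (Real.exp (-(t * y)))).congr (Filter.Eventually.of_forall fun x => ?_)
  simp only
  rw [← Real.exp_add]
  congr 1
  ring

/-- A probability measure whose characteristic function is the exponential of a polynomial of
degree at most two is Gaussian (possibly degenerate). Hermitian symmetry makes the mean and the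
variance real, and boundedness makes the variance nonnegative. -/
lemma eq_gaussianReal_of_charFun_eq {μ : Measure ℝ} [IsProbabilityMeasure μ] {b c : ℂ}
    (h : ∀ t : ℝ, charFun μ t = Complex.exp (b * (t * Complex.I) - c * t ^ 2)) :
    ∃ (m : ℝ) (v : ℝ≥0), μ = gaussianReal m v := by
  have hnorm : ∀ t : ℝ, ‖charFun μ t‖ = Real.exp (-(b.im * t) - c.re * t ^ 2) := by
    intro t
    rw [h, Complex.norm_exp]
    congr 1
    simp [← Complex.ofReal_pow]
  have hb : b.im = 0 := by
    have h1 := hnorm 1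
    have h2 := hnorm (-1)
    rw [charFun_neg, Complex.norm_conj, h1, Real.exp_eq_exp] at h2
    linarith
  have hc0 : 0 ≤ c.re := by
    have h1 := norm_charFun_le_one (μ := μ) 1
    rw [hnorm, Real.exp_le_one_iff, hb] at h1
    linarith
  have hb' : b = (b.re : ℂ) := Complex.ext rfl (by simpa using hb)
  have hc : c.im = 0 := by
    by_contra hne
    -- At this point the two sides of the Hermitian symmetry differ by the factor `-1`.
    obtain ⟨s, hs⟩ : ∃ s : ℝ, s = Real.sqrt (Real.pi / (2 * |c.im|)) := ⟨_, rfl⟩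
    have hs2 : 2 * |c.im| * s ^ 2 = Real.pi := by
      rw [hs, Real.sq_sqrt (by positivity)]
      have : |c.im| ≠ 0 := abs_ne_zero.2 hne
      field_simp
    have h1 := charFun_neg (μ := μ) s
    rw [h, h, ← Complex.exp_conj] at h1
    simp only [map_sub, map_mul, map_pow, Complex.conj_ofReal, Complex.conj_I] at h1
    rw [hb', Complex.conj_ofReal, Complex.exp_eq_exp_iff_exists_int] at h1
    obtain ⟨n, hn⟩ := h1
    have h2 := congrArg Complex.im hn
    simp [← Complex.ofReal_pow] at h2
    have h3 : c.im * s ^ 2 * 2 = -(n * 2 * Real.pi) := by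
      linarith
    have h4 : |c.im * s ^ 2 * 2| = Real.pi := by
      rw [abs_mul, abs_mul, abs_of_nonneg (sq_nonneg s), abs_of_pos (two_pos (α := ℝ)), ← hs2]
      ring
    rw [h3, abs_neg, abs_mul, abs_mul, abs_of_pos Real.pi_pos, abs_of_pos (two_pos (α := ℝ)),
      mul_eq_right₀ Real.pi_pos.ne'] at h4
    have h5 : |n| * 2 = 1 := by exact_mod_cast h4
    omega
  have hc' : c = (c.re : ℂ) := Complex.ext rfl (by simpa using hc)
  refine ⟨b.re, Real.toNNReal (2 * c.re), Measure.ext_of_charFun ?_⟩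
  ext t
  rw [h, charFun_gaussianReal]
  congr 1
  conv_lhs => rw [hb', hc']
  rw [Real.coe_toNNReal _ (by positivity)]
  simp only [Complex.ofReal_mul, Complex.ofReal_ofNat]
  ring

/-- A combination of the theorems of Cramér and Marcinkiewicz: a law with all moments such that
`‖φ‖²` is the exponential of a polynomial near `0`, where `φ` is its characteristic function, is
Gaussian (possibly degenerate). -/
theorem eq_gaussianReal_of_norm_sq_charFun_eq_exp {μ : Measure ℝ} [IsProbabilityMeasure μ]
    (hμ : ∀ k : ℕ, MemLp id k μ) {p : Polynomial ℝ} {η : ℝ} (hη : 0 < η)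
    (hp : ∀ t ∈ Ioo (-η) η, ‖charFun μ t‖ ^ 2 = Real.exp (p.eval t)) :
    ∃ (m : ℝ) (v : ℝ≥0), μ = gaussianReal m v := by
  let pc : Polynomial ℂ := p.map Complex.ofRealHom
  have hpc : ∀ t : ℝ, pc.eval (t : ℂ) = ((p.eval t : ℝ) : ℂ) := fun t => by
    simp only [pc]
    exact Polynomial.eval_map_apply (f := Complex.ofRealHom) t
  have hnhds : Ioo (-η) η ∈ nhds (0 : ℝ) := Ioo_mem_nhds (by linarith) hη
  have hexp : ∀ t, Integrable (fun x => Real.exp (t * x)) μ :=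
    integrable_exp_mul_of_norm_sq_charFun_eq hμ
      (F := fun z => Complex.exp (pc.eval z)) (by fun_prop) (by
        filter_upwards [hnhds] with t ht
        rw [hp t ht, hpc, Complex.ofReal_exp])
  have hset : integrableExpSet id μ = univ := eq_univ_of_forall fun t => hexp t
  have hMd : Differentiable ℂ (complexMGF id μ) := fun z =>
    (hasDerivAt_complexMGF (by simp [hset])).differentiableAt
  -- The identity `φ t * φ (-t) = exp (p t)` extends to the whole plane.
  have hprod : ∀ z, complexMGF id μ z * complexMGF id μ (-z)
      = Complex.exp (pc.eval (-Complex.I * z)) := by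
    have hL : Differentiable ℂ fun z => complexMGF id μ z * complexMGF id μ (-z) :=
      hMd.mul (hMd.comp differentiable_neg)
    have hR : Differentiable ℂ fun z => Complex.exp (pc.eval (-Complex.I * z)) :=
      (pc.differentiable.comp (differentiable_id.const_mul _)).cexp
    have hfreq : ∃ᶠ z in nhdsWithin (0 : ℂ) {0}ᶜ, complexMGF id μ z * complexMGF id μ (-z)
        = Complex.exp (pc.eval (-Complex.I * z)) := by
      have htend : Filter.Tendsto (fun t : ℝ => (t : ℂ) * Complex.I) (nhdsWithin 0 {0}ᶜ)
          (nhdsWithin 0 {0}ᶜ) := by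
        refine tendsto_nhdsWithin_iff.2 ⟨?_, ?_⟩
        · have : Continuous fun t : ℝ => (t : ℂ) * Complex.I := by fun_prop
          have h0 := this.tendsto 0
          rw [Complex.ofReal_zero, zero_mul] at h0
          exact h0.mono_left nhdsWithin_le_nhds
        · filter_upwards [self_mem_nhdsWithin] with t ht
          simpa using ht
      refine htend.frequently (Filter.Eventually.frequently ?_)
      filter_upwards [nhdsWithin_le_nhds hnhds] with t ht
      have h1 : -((t : ℂ) * Complex.I) = ((-t : ℝ) : ℂ) * Complex.I := by push_cast; ring
      have h2 : -Complex.I * ((t : ℂ) * Complex.I) = t := by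
        linear_combination (-(t : ℂ)) * Complex.I_mul_I
      rw [h1, h2, complexMGF_id_mul_I, complexMGF_id_mul_I, charFun_neg, Complex.mul_conj,
        Complex.normSq_eq_norm_sq, hp t ht, hpc, Complex.ofReal_exp]
    have := AnalyticOnNhd.eq_of_frequently_eq
      (hL.differentiableOn.analyticOnNhd isOpen_univ)
      (hR.differentiableOn.analyticOnNhd isOpen_univ) hfreq
    exact fun z => congrFun this z
  have hM0 : ∀ z, complexMGF id μ z ≠ 0 := fun z h0 => by
    have := hprod z
    rw [h0, zero_mul] at this
    exact Complex.exp_ne_zero _ this.symm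
  obtain ⟨Q, hQd, hQ⟩ := exists_eq_exp_of_differentiable hMd hM0
  have hQre : ∀ z, Real.exp (Q z).re = ‖complexMGF id μ z‖ := fun z => by
    rw [hQ, Complex.norm_exp]
  have hQreal : ∀ x : ℝ, Real.exp (Q x).re = mgf id μ x := fun x => by
    rw [hQre, complexMGF_ofReal, Complex.norm_real, Real.norm_of_nonneg mgf_nonneg]
  have hQmax : ∀ z, (Q z).re ≤ (Q (z.re : ℂ)).re := fun z => by
    rw [← Real.exp_le_exp, hQre, hQreal]
    exact norm_complexMGF_le_mgf
  -- Jensen's inequality in the form `exp u ≥ 1 + u`.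
  obtain ⟨m, hm⟩ : ∃ m : ℝ, m = ∫ x, x ∂μ := ⟨_, rfl⟩
  have hint : Integrable (fun x : ℝ => x) μ := by
    have := hμ 1
    rw [Nat.cast_one, memLp_one_iff_integrable] at this
    exact this
  have hjensen : ∀ x : ℝ, x * m ≤ (Q x).re := by
    intro x
    rw [← Real.exp_le_exp, hQreal]
    have h1 : ∫ y, Real.exp (x * m) * (1 + (x * y - x * m)) ∂μ ≤ ∫ y, Real.exp (x * y) ∂μ := by
      refine integral_mono ?_ (hexp x) fun y => ?_
      · exact ((integrable_const _).add ((hint.const_mul x).sub (integrable_const _))).const_mul _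
      · calc Real.exp (x * m) * (1 + (x * y - x * m))
            ≤ Real.exp (x * m) * Real.exp (x * y - x * m) := by
              gcongr
              linarith [Real.add_one_le_exp (x * y - x * m)]
          _ = Real.exp (x * y) := by rw [← Real.exp_add]; congr 1; ring
    have h2 : ∫ y, (1 + (x * y - x * m)) ∂μ = 1 := by
      have h3 : Integrable (fun y => x * y - x * m) μ :=
        (hint.const_mul x).sub (integrable_const _)
      rw [integral_add (integrable_const _) h3, integral_sub (hint.const_mul x)
        (integrable_const _), integral_const_mul, ← hm]
      simp
    rw [integral_const_mul, h2, mul_one] at h1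
    exact h1
  obtain ⟨C, hC0, n, hC⟩ := pc.exists_norm_eval_le
  have hgrowth : ∀ z, (Q z).re ≤ (C + |m|) * (1 + ‖z‖) ^ (n + 1) := by
    intro z
    obtain ⟨x, hx⟩ : ∃ x : ℝ, x = z.re := ⟨_, rfl⟩
    have hxz : |x| ≤ ‖z‖ := hx ▸ Complex.abs_re_le_norm z
    have h1 : (Q x).re + (Q (-x : ℂ)).re ≤ C * (1 + ‖z‖) ^ n := by
      have h2 := congrArg norm (hprod x)
      rw [norm_mul, ← hQre, ← hQre, Complex.norm_exp, ← Real.exp_add, Real.exp_eq_exp] at h2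
      rw [h2]
      refine (Complex.re_le_norm _).trans ((hC _).trans ?_)
      have : ‖-Complex.I * (x : ℂ)‖ = |x| := by simp
      rw [this]
      gcongr
    have h3 := hjensen (-x)
    rw [Complex.ofReal_neg] at h3
    have h4 : x * m ≤ |m| * (1 + ‖z‖) ^ (n + 1) := by
      calc x * m ≤ |x| * |m| := by rw [← abs_mul]; exact le_abs_self _
        _ ≤ (1 + ‖z‖) * |m| := by gcongr; linarith
        _ = |m| * (1 + ‖z‖) ^ 1 := by ring
        _ ≤ |m| * (1 + ‖z‖) ^ (n + 1) := by
          gcongr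
          · linarith [norm_nonneg z]
          · omega
    have h5 : C * (1 + ‖z‖) ^ n ≤ C * (1 + ‖z‖) ^ (n + 1) := by
      gcongr
      · linarith [norm_nonneg z]
      · omega
    have h6 := hQmax z
    rw [← hx] at h6
    nlinarith
  obtain ⟨P, hP⟩ := exists_polynomial_of_differentiable_of_re_le hQd (by positivity) hgrowth
  have hdeg : P.natDegree ≤ 2 := P.natDegree_le_two_of_re_le fun z => by
    rw [← hP, ← hP]
    exact hQmax z
  have hPeval : ∀ z, Q z = P.coeff 0 + P.coeff 1 * z + P.coeff 2 * z ^ 2 := fun z => by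
    rw [hP, Polynomial.eval_eq_sum_range' (Nat.lt_succ_of_le hdeg)]
    simp [Finset.sum_range_succ]
  have hc0 : Complex.exp (P.coeff 0) = 1 := by
    have h1 := hQ 0
    rw [hPeval] at h1
    have h2 := complexMGF_id_mul_I (μ := μ) 0
    simp only [Complex.ofReal_zero, zero_mul, charFun_zero, probReal_univ,
      Complex.ofReal_one] at h2
    simpa [h2] using h1.symm
  refine eq_gaussianReal_of_charFun_eq (b := P.coeff 1) (c := P.coeff 2) fun t => ?_
  rw [← complexMGF_id_mul_I, hQ, hPeval, add_assoc, Complex.exp_add, hc0, one_mul, mul_pow,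
    Complex.I_sq]
  congr 1
  ring

/-! ### Identification of the coefficients of a linear combination -/

lemma ContDiffAt.hasDerivAt_iteratedDeriv {g : ℝ → ℝ} {t : ℝ}
    (hg : ContDiffAt ℝ (⊤ : ℕ∞) g t) (k : ℕ) :
    HasDerivAt (iteratedDeriv k g) (iteratedDeriv (k + 1) g t) t := by
  have h1 : DifferentiableAt ℝ (iteratedFDeriv ℝ k g) t :=
    hg.differentiableAt_iteratedFDeriv (by exact_mod_cast ENat.natCast_lt_top k)
  have h2 : DifferentiableAt ℝ (iteratedDeriv k g) t := by
    rw [iteratedDeriv_eq_equiv_comp]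
    exact (LinearIsometryEquiv.differentiableAt _).comp t h1
  rw [iteratedDeriv_succ]
  exact h2.hasDerivAt

/-- For a non-Gaussian law with all moments, the law of a linear combination of independent copies
determines the absolute values of the coefficients up to order. -/
theorem exists_perm_abs_eq_of_prod_charFun_eq {μ : Measure ℝ} [IsProbabilityMeasure μ]
    (hμ : ∀ k : ℕ, MemLp id k μ) (hgauss : ∀ (m : ℝ) (v : ℝ≥0), μ ≠ gaussianReal m v)
    {ι : Type*} [Fintype ι] {a b : ι → ℝ}
    (h : ∀ t, ∏ i, charFun μ (a i * t) = ∏ i, charFun μ (b i * t)) :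
    ∃ σ : Equiv.Perm ι, ∀ i, |a i| = |b (σ i)| := by
  let g : ℝ → ℝ := fun t => Real.log (‖charFun μ t‖ ^ 2)
  have hsmooth : ContDiff ℝ (⊤ : ℕ∞) (charFun μ) := contDiff_charFun' hμ
  obtain ⟨δ, hδ, hne⟩ : ∃ δ > 0, ∀ t ∈ Ioo (-δ) δ, charFun μ t ≠ 0 := by
    have h0 : charFun μ 0 ≠ 0 := by simp
    obtain ⟨δ, hδ, hball⟩ := Metric.eventually_nhds_iff.1
      (hsmooth.continuous.continuousAt.eventually_ne h0)
    exact ⟨δ, hδ, fun t ht => hball (by simpa using abs_lt.2 ht)⟩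
  have hpos : ∀ t ∈ Ioo (-δ) δ, 0 < ‖charFun μ t‖ ^ 2 := fun t ht =>
    pow_pos (norm_pos_iff.2 (hne t ht)) 2
  have hg : ∀ t ∈ Ioo (-δ) δ, ContDiffAt ℝ (⊤ : ℕ∞) g t := fun t ht =>
    ((hsmooth.norm_sq ℝ).contDiffAt).log (hpos t ht).ne'
  have heven : ∀ s t : ℝ, ‖charFun μ (|s| * t)‖ = ‖charFun μ (s * t)‖ := by
    intro s t
    rcases abs_choice s with hs | hs
    · rw [hs]
    · rw [hs, neg_mul, charFun_neg, Complex.norm_conj]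
  rcases exists_perm_or_polynomial_of_sum_dilate_eq hδ (h := fun k => iteratedDeriv k g)
    (fun k t ht => (hg t ht).hasDerivAt_iteratedDeriv k) (a := fun i => |a i|)
    (b := fun i => |b i|) (fun i => abs_nonneg _) (fun i => abs_nonneg _) (by
      intro t hat hbt
      simp only [iteratedDeriv_zero, g]
      rw [← Real.log_prod fun i _ => (hpos _ (hat i)).ne',
        ← Real.log_prod fun i _ => (hpos _ (hbt i)).ne']
      congr 1
      have h1 := congrArg norm (h t)
      rw [norm_prod, norm_prod] at h1
      simp only [heven, Finset.prod_pow, h1]) with hσ | ⟨p, η, hη, hp⟩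
  · exact hσ
  · exfalso
    obtain ⟨m, v, hmv⟩ := eq_gaussianReal_of_norm_sq_charFun_eq_exp hμ (p := p)
      (lt_min hη hδ) fun t ht => by
        have h1 : t ∈ Ioo (-η) η := ⟨by linarith [ht.1, min_le_left η δ],
          ht.2.trans_le (min_le_left _ _)⟩
        have h2 : t ∈ Ioo (-δ) δ := ⟨by linarith [ht.1, min_le_right η δ],
          ht.2.trans_le (min_le_right _ _)⟩
        have h3 := hp t h1
        simp only [iteratedDeriv_zero, g] at h3
        rw [← h3, Real.exp_log (hpos t h2)]
    exact hgauss m v hmv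

/-! ### Laws with densities -/

/-- The probability measure on `ℝ` with Lebesgue density `f`. -/
noncomputable def densityLaw (f : ℝ → ℝ) : Measure ℝ :=
  volume.withDensity fun x => ENNReal.ofReal (f x)

lemma IsProbDensity.isProbabilityMeasure {f : ℝ → ℝ} (hf : IsProbDensity f) :
    IsProbabilityMeasure (densityLaw f) := by
  refine ⟨?_⟩
  rw [densityLaw, withDensity_apply _ MeasurableSet.univ, Measure.restrict_univ,
    ← ofReal_integral_eq_lintegral_ofReal hf.integrable
      (Filter.Eventually.of_forall hf.nonneg), hf.integral_eq_one, ENNReal.ofReal_one]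

lemma IsProbDensity.memLp_id {f : ℝ → ℝ} (hf : IsProbDensity f) (hmom : HasAllMoments f) (k : ℕ) :
    MemLp id k (densityLaw f) := by
  rcases Nat.eq_zero_or_pos k with rfl | hk
  · rw [Nat.cast_zero, memLp_zero_iff_aestronglyMeasurable]
    exact aestronglyMeasurable_id
  · rw [← integrable_norm_rpow_iff aestronglyMeasurable_id (by exact_mod_cast hk.ne')
      (ENNReal.natCast_ne_top k), densityLaw, integrable_withDensity_iff
      hf.measurable.ennreal_ofReal (Filter.Eventually.of_forall fun x => ENNReal.ofReal_lt_top)]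
    refine (hmom k hk).congr (Filter.Eventually.of_forall fun x => ?_)
    simp [ENNReal.toReal_ofReal (hf.nonneg x)]

lemma charFun_densityLaw {f : ℝ → ℝ} (hf : Measurable f) (hf0 : ∀ x, 0 ≤ f x)
    (t : ℝ) : charFun (densityLaw f) t = ∫ x, (f x : ℂ) * Complex.exp (t * x * Complex.I) := by
  rw [charFun_apply_real, densityLaw, integral_withDensity_eq_integral_toReal_smul
    hf.ennreal_ofReal (Filter.Eventually.of_forall fun x => ENNReal.ofReal_lt_top)]
  refine integral_congr_ae (Filter.Eventually.of_forall fun x => ?_)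
  simp [ENNReal.toReal_ofReal (hf0 x)]

lemma IsProbDensity.charFun_densityLaw_scaleDensity {f : ℝ → ℝ} (hf : IsProbDensity f) {l : ℝ}
    (hl : 0 < l) (t : ℝ) :
    charFun (densityLaw (scaleDensity f l)) t = charFun (densityLaw f) (t / l) := by
  have hmeas : Measurable (scaleDensity f l) :=
    (hf.measurable.comp (measurable_const_mul l)).const_mul l
  rw [charFun_densityLaw hmeas fun x => mul_nonneg hl.le (hf.nonneg _),
    charFun_densityLaw hf.measurable hf.nonneg]
  have hl' : (l : ℂ) ≠ 0 := by exact_mod_cast hl.ne'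
  have h1 := Measure.integral_comp_mul_left
    (fun y : ℝ => (f y : ℂ) * Complex.exp ((t / l : ℝ) * y * Complex.I)) l
  rw [abs_of_pos (inv_pos.2 hl), Complex.real_smul, Complex.ofReal_inv, eq_inv_mul_iff_mul_eq₀ hl',
    ← integral_const_mul] at h1
  rw [← h1]
  refine integral_congr_ae (Filter.Eventually.of_forall fun x => ?_)
  simp only [scaleDensity, Complex.ofReal_mul, Complex.ofReal_div]
  rw [show (t : ℂ) / l * (l * x) * Complex.I = t * x * Complex.I by field_simp]
  ring

lemma IsSymmetricDensity.charFun_neg {f : ℝ → ℝ} (hf : IsProbDensity f)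
    (hsymm : IsSymmetricDensity f) (t : ℝ) :
    charFun (densityLaw f) (-t) = charFun (densityLaw f) t := by
  rw [charFun_densityLaw hf.measurable hf.nonneg,
    charFun_densityLaw hf.measurable hf.nonneg, ← integral_neg_eq_self]
  refine integral_congr_ae ?_
  filter_upwards [hsymm] with x hx
  rw [hx]
  push_cast
  ring_nf

lemma IsProbDensity.densityLaw_ne_gaussianReal {f : ℝ → ℝ} (hf : IsProbDensity f)
    (hgauss : ¬ IsGaussianDensity f) (m : ℝ) (v : ℝ≥0) : densityLaw f ≠ gaussianReal m v := by
  intro h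
  by_cases hv : v = 0
  · -- A law with a density has no atoms.
    rw [hv, gaussianReal_zero_var] at h
    have h1 : densityLaw f {m} = 0 :=
      withDensity_absolutelyContinuous _ _ Real.volume_singleton
    rw [h] at h1
    simp at h1
  · refine hgauss ⟨m, v, hv, ?_⟩
    rw [gaussianReal_of_var_ne_zero _ hv, densityLaw] at h
    have h1 := (withDensity_eq_iff hf.measurable.ennreal_ofReal.aemeasurable
      (measurable_gaussianPDF m v).aemeasurable (by
        rw [← ofReal_integral_eq_lintegral_ofReal hf.integrable
          (Filter.Eventually.of_forall hf.nonneg)]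
        exact ENNReal.ofReal_ne_top)).1 h
    filter_upwards [h1] with x hx
    exact (ENNReal.ofReal_eq_ofReal_iff (hf.nonneg x) (gaussianPDFReal_nonneg m v x)).1 hx

/-! ### Unlinked linear regression -/

lemma charFun_map_linear_combination_add {Ω : Type*} [MeasurableSpace Ω] {P : Measure Ω}
    [IsProbabilityMeasure P] {f : ℝ → ℝ} (hf : IsProbDensity f) {d : ℕ} {lam : Fin d → ℝ}
    (hlam : ∀ j, 0 < lam j) {X : Ω → Fin d → ℝ}
    (hX_density : ∀ j, HasDensity P (fun ω => X ω j) (scaleDensity f (lam j)))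
    (hX_indep : iIndepFun (fun j ω => X ω j) P)
    {ε : Ω → ℝ} (hε_meas : AEMeasurable ε P) (hε_indep : IndepFun X ε P)
    (β : Fin d → ℝ) (t : ℝ) :
    charFun (P.map fun ω => (∑ j, β j * X ω j) + ε ω) t
      = (∏ j, charFun (densityLaw f) (β j / lam j * t)) * charFun (P.map ε) t := by
  have hmeas : ∀ j, AEMeasurable (fun ω => β j * X ω j) P := fun j =>
    (hX_density j).1.const_mul (β j)
  have hindep : IndepFun (fun ω => ∑ j, β j * X ω j) ε P :=
    hε_indep.comp (φ := fun x : Fin d → ℝ => ∑ j, β j * x j) (ψ := id) (by fun_prop)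
      measurable_id
  have hindep' : iIndepFun (fun j ω => β j * X ω j) P :=
    hX_indep.comp (fun j x => β j * x) fun j => measurable_const_mul (β j)
  rw [hindep.charFun_map_fun_add_eq_mul (Finset.aemeasurable_fun_sum _ fun j _ => hmeas j)
    hε_meas, Pi.mul_apply, hindep'.charFun_map_fun_sum_eq_prod hmeas, Finset.prod_apply]
  congr 1
  refine Finset.prod_congr rfl fun j _ => ?_
  rw [charFun_map_mul_comp (hX_density j).1, (hX_density j).2]
  have := hf.charFun_densityLaw_scaleDensity (hlam j) (β j * t)
  rw [densityLaw] at this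
  rw [this]
  congr 1
  ring

theorem mainTheorem3 {Ω Ω' : Type*} [MeasurableSpace Ω] [MeasurableSpace Ω']
    (P : Measure Ω) [IsProbabilityMeasure P] (P' : Measure Ω') [IsProbabilityMeasure P']
    (f : ℝ → ℝ) (hf : IsProbDensity f) (hf_gauss : ¬ IsGaussianDensity f)
    (hf_mom : HasAllMoments f)
    {d : ℕ} (lam : Fin d → ℝ) (hlam : ∀ j, 0 < lam j)
    (X : Ω → Fin d → ℝ)
    (hX_density : ∀ j, HasDensity P (fun ω => X ω j) (scaleDensity f (lam j)))
    (hX_indep : iIndepFun (fun j ω => X ω j) P)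
    (ε : Ω → ℝ) (hε_meas : AEMeasurable ε P) (hε_indep : IndepFun X ε P)
    (hε_char : ∀ a b : ℝ, a < b → ¬ (Ioo a b ⊆ {t : ℝ | charFun (P.map ε) t = 0}))
    (Y : Ω' → ℝ)
    (β₀ : Fin d → ℝ) (hβ₀ : β₀ ∈ regressionVectors P P' X ε Y) :
    {β : Fin d → ℝ | ∃ σ : Equiv.Perm (Fin d), ∀ j, β j = lam j / lam (σ j) * β₀ (σ j)}
        ⊆ regressionVectors P P' X ε Y ∧
    regressionVectors P P' X ε Y
        ⊆ {β : Fin d → ℝ |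
            ∃ σ : Equiv.Perm (Fin d), ∀ j, |β j| = lam j / lam (σ j) * |β₀ (σ j)|} ∧
    (IsSymmetricDensity f →
      regressionVectors P P' X ε Y
        = {β : Fin d → ℝ |
            ∃ σ : Equiv.Perm (Fin d), ∀ j, |β j| = lam j / lam (σ j) * |β₀ (σ j)|}) := by
  have := hf.isProbabilityMeasure
  have : IsProbabilityMeasure (P.map ε) := Measure.isProbabilityMeasure_map hε_meas
  have hsum_meas : ∀ β : Fin d → ℝ, AEMeasurable (fun ω => (∑ j, β j * X ω j) + ε ω) P :=
    fun β => (Finset.aemeasurable_fun_sum _ fun j _ =>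
      (hX_density j).1.const_mul (β j)).add hε_meas
  have hchar := charFun_map_linear_combination_add hf hlam hX_density hX_indep hε_meas hε_indep
  have hdense : Dense {t : ℝ | charFun (P.map ε) t ≠ 0} := by
    refine dense_iff_inter_open.2 fun U hU hUne => ?_
    obtain ⟨x, hx⟩ := hUne
    obtain ⟨a, b, hab, hsub⟩ := mem_nhds_iff_exists_Ioo_subset.1 (hU.mem_nhds hx)
    obtain ⟨y, hy, hy0⟩ := not_subset.1 (hε_char a b (hab.1.trans hab.2))
    exact ⟨y, hsub hy, hy0⟩
  -- Cancelling the characteristic function of the error on a dense set.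
  have hmem : ∀ β, β ∈ regressionVectors P P' X ε Y ↔
      ∀ t, ∏ j, charFun (densityLaw f) (β j / lam j * t)
        = ∏ j, charFun (densityLaw f) (β₀ j / lam j * t) := by
    intro β
    constructor
    · intro hβ
      have hmap := hβ.map_eq.symm.trans hβ₀.map_eq
      have hcont : ∀ γ : Fin d → ℝ,
          Continuous fun t => ∏ j, charFun (densityLaw f) (γ j / lam j * t) := fun γ =>
        continuous_finsetProd _ fun j _ => continuous_charFun.comp (continuous_const_mul _)
      refine congrFun ((hcont β).ext_on hdense (hcont β₀) fun t ht => ?_)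
      have h1 := hchar β t
      rw [hmap, hchar β₀ t] at h1
      exact (mul_right_cancel₀ ht h1).symm
    · intro h
      refine ⟨hβ₀.aemeasurable_fst, hsum_meas β, ?_⟩
      rw [hβ₀.map_eq]
      have := Measure.isProbabilityMeasure_map (hsum_meas β)
      have := Measure.isProbabilityMeasure_map (hsum_meas β₀)
      refine Measure.ext_of_charFun (funext fun t => ?_)
      rw [hchar, hchar, h]
  have hmain : regressionVectors P P' X ε Y ⊆ {β : Fin d → ℝ |
      ∃ σ : Equiv.Perm (Fin d), ∀ j, |β j| = lam j / lam (σ j) * |β₀ (σ j)|} := by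
    intro β hβ
    obtain ⟨σ, hσ⟩ := exists_perm_abs_eq_of_prod_charFun_eq (hf.memLp_id hf_mom)
      (hf.densityLaw_ne_gaussianReal hf_gauss) ((hmem β).1 hβ)
    refine ⟨σ, fun j => ?_⟩
    have h1 := hσ j
    rw [abs_div, abs_div, abs_of_pos (hlam j), abs_of_pos (hlam (σ j)),
      div_eq_iff (hlam j).ne'] at h1
    rw [h1]
    ring
  refine ⟨?_, hmain, fun hsymm => hmain.antisymm ?_⟩
  · rintro β ⟨σ, hσ⟩
    refine (hmem β).2 fun t => ?_
    rw [← Equiv.prod_comp σ fun j => charFun (densityLaw f) (β₀ j / lam j * t)]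
    refine Finset.prod_congr rfl fun j _ => ?_
    have := (hlam j).ne'
    rw [hσ j]
    congr 2
    field_simp
  · rintro β ⟨σ, hσ⟩
    refine (hmem β).2 fun t => ?_
    rw [← Equiv.prod_comp σ fun j => charFun (densityLaw f) (β₀ j / lam j * t)]
    refine Finset.prod_congr rfl fun j _ => ?_
    have hj := (hlam j).ne'
    have habs : |β j / lam j| = |β₀ (σ j) / lam (σ j)| := by
      rw [abs_div, abs_div, abs_of_pos (hlam j), abs_of_pos (hlam (σ j)), hσ j]
      field_simp
    rcases abs_eq_abs.1 habs with h | h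
    · rw [h]
    · rw [h, neg_mul, hsymm.charFun_neg hf]
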